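/- Let $V$ be a finite-dimensional simple Euclidean Jordan algebra of rank $2$ (with unit $e$ and an inner product satisfying $\langle xy,z\rangle=\langle y,xz\rangle$), and let $Q=\{x^2 : x\in V\}$ be its cone of squares. For a nonempty closed convex set $D$ let $P_D$ denote the metric projection onto $D$. A set $M$ in a Euclidean space is called lattice-like with respect to a closed convex cone $K$ if $P_{x-K}\,y\in M$ and $P_{x+K}\,y\in M$ for all $x,y\in M$. Write $H_-(u,a)=\{x : \langle a,x\rangle\le\langle a,u\rangle\}$. A Jordan frame of $V$ is a pair of primitive idempotents $c_1,c_2$ with $c_1c_2=0$ and $c_1+c_2=e$. (1) A closed convex set $M\subseteq V$ with nonempty interior is lattice-like with respect to $Q$ if and only if $$M=\bigcap_{i\in I}H_-(u_i,a_i)$$ for some (possibly finite or empty) index set $I\subseteq\mathbb N$, points $u_i\in V$ and vectors $$a_i=\varepsilon_i\left(\frac{\sqrt2}{2}\,c^i_1-\frac{\sqrt2}{2}\,c^i_2\right),\qquad \varepsilon_i\in\{1,-1\},$$ where $\{c^i_1,c^i_2\}$ is a Jordan frame of $V$ for each $i\in I$. If the inner product of $V$ is the trace inner product $\langle x,y\rangle=\operatorname{tr}(xy)$,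 where $\operatorname{tr}(\lambda_1c_1+\lambda_2c_2)=\lambda_1+\lambda_2$ for every Jordan frame $\{c_1,c_2\}$, then all vectors of this form are unit vectors, so that the $a_i$ are unit normals. (2) Let $m\ge 2$, and equip $\mathbb R^m\times\mathbb R$ with the usual scalar product and the Jordan product $(x,s)\circ(y,t)=(tx+sy,\ \langle x,y\rangle+st)$. This is a simple Euclidean Jordan algebra of rank $2$ whose cone of squares is the Lorentz cone $L=\{(x,t) : \|x\|\le t\}$. The closed convex sets with nonempty interior in $\mathbb R^m\times\mathbb R$ that are lattice-like with respect to $L$ are exactly the cylinders $C\times\mathbb R$ with $C\subseteq\mathbb R^m$ closed, convex and with nonempty interior. -/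

import Mathlib

open scoped RealInnerProductSpace

/-! ### Metric projections, lattice-like operations and lattice-like sets -/

section LatticeLike

variable {E : Type*} [NormedAddCommGroup E] [InnerProductSpace ℝ E]

/-- `p` is a nearest point of `D` to `x`. -/
def IsNearestPoint (D : Set E) (x p : E) : Prop :=
  p ∈ D ∧ ∀ y ∈ D, ‖x - p‖ ≤ ‖x - y‖

/-- The metric projection `P_D x`: the nearest point of `D` to `x`. It is meaningful for nonempty
closed convex sets `D`, see `isNearestPoint_iff_eq_metricProj`. -/
noncomputable def metricProj (D : Set E) (x : E) : E :=
  Classical.epsilon (IsNearestPoint D x)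

/-- For a nonempty closed convex set the nearest point exists, is unique, and is the value of
`metricProj`. -/
theorem isNearestPoint_iff_eq_metricProj [CompleteSpace E] {D : Set E} (hne : D.Nonempty)
    (hcl : IsClosed D) (hcv : Convex ℝ D) (x p : E) :
    IsNearestPoint D x p ↔ p = metricProj D x := by
  have key : ∀ q, IsNearestPoint D x q → q ∈ D ∧ ∀ w ∈ D, ⟪x - q, w - q⟫ ≤ 0 := by
    rintro q ⟨hq, hmin⟩
    refine ⟨hq, (norm_eq_iInf_iff_real_inner_le_zero hcv hq).1 (le_antisymm ?_ ?_)⟩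
    · have : Nonempty D := ⟨⟨q, hq⟩⟩
      exact le_ciInf fun w => hmin w w.2
    · exact ciInf_le ⟨0, by rintro _ ⟨w, rfl⟩; exact norm_nonneg _⟩ (⟨q, hq⟩ : D)
  have uniq : ∀ q r, IsNearestPoint D x q → IsNearestPoint D x r → q = r := by
    intro q r hq hr
    obtain ⟨hqD, hq'⟩ := key q hq
    obtain ⟨hrD, hr'⟩ := key r hr
    have h1 := hq' r hrD
    have h2 := hr' q hqD
    have h3 : ⟪q - r, q - r⟫ = ⟪x - q, r - q⟫ + ⟪x - r, q - r⟫ := by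
      simp only [inner_sub_left, inner_sub_right]; ring
    have h4 : ⟪q - r, q - r⟫ ≤ 0 := by rw [h3]; linarith
    exact sub_eq_zero.1 (inner_self_eq_zero.1 (le_antisymm h4 real_inner_self_nonneg))
  have ex : ∃ q, IsNearestPoint D x q := by
    obtain ⟨q, hq, hmin⟩ := exists_norm_eq_iInf_of_complete_convex hne hcl.isComplete hcv x
    refine ⟨q, hq, fun y hy => ?_⟩
    rw [hmin]
    exact ciInf_le ⟨0, by rintro _ ⟨w, rfl⟩; exact norm_nonneg _⟩ (⟨y, hy⟩ : D)
  have hs : IsNearestPoint D x (metricProj D x) := Classical.epsilon_spec ex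
  exact ⟨fun h => uniq _ _ h hs, fun h => h ▸ hs⟩

/-- The lower lattice-like operation `x ⊓_K y = P_{x - K} y`. -/
noncomputable def conicInf (K : Set E) (x y : E) : E :=
  metricProj ((fun k => x - k) '' K) y

/-- The upper lattice-like operation `x ⊔_K y = P_{x + K} y`. -/
noncomputable def conicSup (K : Set E) (x y : E) : E :=
  metricProj ((fun k => x + k) '' K) y

/-- A set is lattice-like with respect to the cone `K` if it is invariant under both lattice-like
operations. -/
def IsLatticeLike (K M : Set E) : Prop :=
  ∀ x ∈ M, ∀ y ∈ M, conicInf K x y ∈ M ∧ conicSup K x y ∈ M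

/-- The closed halfspace `H₋(u, a) = {x : ⟪a, x⟫ ≤ ⟪a, u⟫}`. -/
def lowerHalfspace (u a : E) : Set E :=
  {x | ⟪a, x⟫ ≤ ⟪a, u⟫}

end LatticeLike

/-! ### Euclidean Jordan algebras -/

/-- The structure of a Euclidean Jordan algebra (with unit) on a real inner product space `V`,
to be used for finite-dimensional `V`: a bilinear commutative product with unit which satisfies
the Jordan identity `x (x² y) = x² (x y)` and for which the inner product is associative. -/
structure EuclideanJordanAlgebra (V : Type*) [NormedAddCommGroup V] [InnerProductSpace ℝ V] where
  /-- the Jordan product -/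
  mul : V →ₗ[ℝ] V →ₗ[ℝ] V
  /-- the unit -/
  one : V
  mul_comm : ∀ x y, mul x y = mul y x
  one_mul : ∀ x, mul one x = x
  jordan : ∀ x y, mul x (mul (mul x x) y) = mul (mul x x) (mul x y)
  inner_mul : ∀ x y z, ⟪mul x y, z⟫ = ⟪y, mul x z⟫

namespace EuclideanJordanAlgebra

variable {V : Type*} [NormedAddCommGroup V] [InnerProductSpace ℝ V]
  (J : EuclideanJordanAlgebra V)

/-- The cone of squares. -/
def squares : Set V :=
  Set.range fun x => J.mul x x

/-- Powers with respect to the Jordan product. -/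
def pow (x : V) : ℕ → V
  | 0 => J.one
  | n + 1 => J.mul x (pow x n)

/-- The degree of `x`: the least `k > 0` such that `e, x, …, x ^ k` are linearly dependent. -/
noncomputable def degree (x : V) : ℕ :=
  sInf {k | 0 < k ∧ ¬ LinearIndependent ℝ fun i : Fin (k + 1) => J.pow x i}

/-- The rank: the largest degree of an element. -/
noncomputable def rank : ℕ :=
  sSup (Set.range J.degree)

/-- A Jordan algebra is simple if it is nonzero and has no ideals other than `0` and itself. -/
def IsSimple : Prop :=
  Nontrivial V ∧
    ∀ I : Submodule ℝ V, (∀ x, ∀ y ∈ I, J.mul x y ∈ I) → I = ⊥ ∨ I = ⊤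

/-- An idempotent. -/
def IsIdempotent (c : V) : Prop :=
  J.mul c c = c

/-- A primitive idempotent: nonzero, and not a sum of two nonzero idempotents. -/
def IsPrimitive (c : V) : Prop :=
  J.IsIdempotent c ∧ c ≠ 0 ∧
    ∀ p q, J.IsIdempotent p → J.IsIdempotent q → c = p + q → p = 0 ∨ q = 0

/-- A Jordan frame: primitive idempotents with pairwise zero products that add up to the unit. -/
def IsJordanFrame {k : ℕ} (c : Fin k → V) : Prop :=
  (∀ i, J.IsPrimitive (c i)) ∧ (∀ i j, i ≠ j → J.mul (c i) (c j) = 0) ∧ ∑ i, c i = J.one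

/-- The inner product of `V` is the trace inner product `⟪x, y⟫ = tr (x y)`, where the trace of
`∑ i, l i • c i`, with `c` a Jordan frame, is the sum `∑ i, l i` of the eigenvalues. -/
def IsTraceInner : Prop :=
  ∀ (x y : V) (k : ℕ) (c : Fin k → V) (l : Fin k → ℝ), J.IsJordanFrame c →
    J.mul x y = ∑ i, l i • c i → ⟪x, y⟫ = ∑ i, l i

end EuclideanJordanAlgebra

/-! ### The Lorentz cone and its Jordan algebra -/

/-- `ℝ^m × ℝ = ℝ^(m+1)` with the usual scalar product. -/
abbrev LorentzSpace (m : ℕ) : Type :=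
  WithLp 2 (EuclideanSpace ℝ (Fin m) × ℝ)

theorem LorentzSpace.ext' {m : ℕ} {p q : LorentzSpace m} (h₁ : ∀ i, p.fst i = q.fst i)
    (h₂ : p.snd = q.snd) : p = q :=
  WithLp.ofLp_injective 2 (Prod.ext (PiLp.ext h₁) h₂)

/-- The Lorentz cone `{(x, t) : ‖x‖ ≤ t}`. -/
def lorentzCone (m : ℕ) : Set (LorentzSpace m) :=
  {p | ‖p.fst‖ ≤ p.snd}

/-- The Jordan product `(x, s) ∘ (y, t) = (t x + s y, ⟪x, y⟫ + s t)` on `ℝ^m × ℝ`, with unit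
`(0, 1)`. -/
noncomputable def lorentzAlgebra (m : ℕ) : EuclideanJordanAlgebra (LorentzSpace m) where
  mul := LinearMap.mk₂ ℝ
    (fun p q => WithLp.toLp 2 (q.snd • p.fst + p.snd • q.fst, ⟪p.fst, q.fst⟫ + p.snd * q.snd))
    (by
      intro p p' q
      refine LorentzSpace.ext' (fun i => ?_) ?_ <;> simp [inner_add_left] <;> ring)
    (by
      intro r p q
      refine LorentzSpace.ext' (fun i => ?_) ?_ <;> simp [inner_smul_left] <;> ring)
    (by
      intro p q q'
      refine LorentzSpace.ext' (fun i => ?_) ?_ <;> simp [inner_add_right] <;> ring)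
    (by
      intro r p q
      refine LorentzSpace.ext' (fun i => ?_) ?_ <;> simp [inner_smul_right] <;> ring)
  one := WithLp.toLp 2 (0, 1)
  mul_comm := by
    intro p q
    refine LorentzSpace.ext' (fun i => ?_) ?_
    · simp; ring
    · simp [real_inner_comm, _root_.mul_comm]
  one_mul := by
    intro p
    refine LorentzSpace.ext' (fun i => ?_) ?_ <;> simp
  jordan := by
    intro p q
    refine LorentzSpace.ext' (fun i => ?_) ?_ <;>
      simp [inner_add_left, inner_add_right, inner_smul_left, inner_smul_right] <;> ring
  inner_mul := by
    intro p q r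
    simp [WithLp.prod_inner_apply, inner_add_left, inner_add_right, inner_smul_left,
      inner_smul_right]
    rw [real_inner_comm p.fst q.fst]
    ring

/-- The cylinder `C × ℝ`. -/
def cylinder {m : ℕ} (C : Set (EuclideanSpace ℝ (Fin m))) : Set (LorentzSpace m) :=
  {p | p.fst ∈ C}

/-! In a simple algebra of rank two, elements orthogonal to the unit `e` square to multiples of `e`
(`isSpin`), so the cone of squares is a circular cone with axis `e`. For such cones, a closed convex
set with interior points is lattice-like exactly when it is invariant under translations along `e`
(`IsCircularCone.isLatticeLike_iff`).

Invariance suffices because the projection of `z` onto the cone is `l • z + s • e` with `0 ≤ l ≤ 1`: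
both operations give a point of the segment from `x` to `y`, shifted along the axis. Conversely,
suppose a ball in `M` touches the boundary at `p` with radius direction not orthogonal to `e`.
Combining `p` with a suitable nearby point of the ball gives a point beyond the supporting
hyperplane at `p` (`inner_axis_eq_zero`); this needs dimension at least three. So touching radii are
orthogonal to `e`, which makes the distance to the complement constant along `e`
(`interior_add_smul_mem`).

Invariant sets are cut out by halfspaces with normals orthogonal to `e`, and, suitably scaled, such
normals are differences of Jordan frames. -/

section Projection

variable {E : Type*} [NormedAddCommGroup E] [InnerProductSpace ℝ E]

/-- A point satisfying the variational inequality is the metric projection. -/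
theorem metricProj_eq_of_inner_le_zero {D : Set E} {y p : E} (hp : p ∈ D)
    (h : ∀ w ∈ D, ⟪y - p, w - p⟫ ≤ 0) : metricProj D y = p := by
  have expand : ∀ q, ‖y - q‖ ^ 2 = ‖y - p‖ ^ 2 - 2 * ⟪y - p, q - p⟫ + ‖q - p‖ ^ 2 := by
    intro q
    rw [← norm_sub_sq_real]
    congr 2
    abel
  have hnear : IsNearestPoint D y p := by
    refine ⟨hp, fun q hq => ?_⟩
    have h1 := expand q
    have h2 := h q hq
    refine le_of_sq_le_sq ?_ (norm_nonneg _)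
    nlinarith [sq_nonneg ‖q - p‖]
  -- `metricProj` only chooses some nearest point; the same expansion at `q` forces `q = p`.
  have hs : IsNearestPoint D y (metricProj D y) := Classical.epsilon_spec ⟨p, hnear⟩
  set q := metricProj D y
  have h1 := expand q
  have h2 := h q hs.1
  have h3 := pow_le_pow_left₀ (norm_nonneg _) (hs.2 p hp) 2
  have h4 : ‖q - p‖ ^ 2 = 0 := le_antisymm (by linarith) (sq_nonneg _)
  exact sub_eq_zero.1 (norm_eq_zero.1 (pow_eq_zero_iff two_ne_zero |>.1 h4))

theorem conicSup_eq_add {K : Set E} {x y q : E} (hq : q ∈ K)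
    (h : ∀ k ∈ K, ⟪y - x - q, k - q⟫ ≤ 0) : conicSup K x y = x + q := by
  refine metricProj_eq_of_inner_le_zero ⟨q, hq, rfl⟩ ?_
  rintro _ ⟨k, hk, rfl⟩
  have := h k hk
  rwa [show y - (x + q) = y - x - q by abel, show x + k - (x + q) = k - q by abel]

theorem conicInf_eq_sub {K : Set E} {x y q : E} (hq : q ∈ K)
    (h : ∀ k ∈ K, ⟪x - y - q, k - q⟫ ≤ 0) : conicInf K x y = x - q := by
  refine metricProj_eq_of_inner_le_zero ⟨q, hq, rfl⟩ ?_
  rintro _ ⟨k, hk, rfl⟩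
  have := h k hk
  rwa [show y - (x - q) = -(x - y - q) by abel, show x - k - (x - q) = -(k - q) by abel,
    inner_neg_neg]

end Projection

/-! ### Projections onto circular cones. -/

section CircularCone

variable {V : Type*} [NormedAddCommGroup V] [InnerProductSpace ℝ V]

/-- `Q` is the circular cone with axis `e`. -/
def IsCircularCone (e : V) (Q : Set V) : Prop :=
  ∀ (w : V) (t : ℝ), ⟪e, w⟫ = 0 → (w + t • e ∈ Q ↔ ‖w‖ ≤ t * ‖e‖)

/-- Orthogonal decomposition with respect to a nonzero vector. -/
theorem exists_eq_add_smul {e : V} (he : e ≠ 0) (x : V) :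
    ∃ (w : V) (t : ℝ), ⟪e, w⟫ = 0 ∧ x = w + t • e := by
  refine ⟨x - (⟪e, x⟫ / ‖e‖ ^ 2) • e, ⟪e, x⟫ / ‖e‖ ^ 2, ?_, by abel⟩
  have : ‖e‖ ≠ 0 := norm_ne_zero_iff.2 he
  rw [inner_sub_right, inner_smul_right, real_inner_self_eq_norm_sq]
  field_simp
  ring

/-- The coefficients with respect to a nonzero vector and its orthogonal complement are unique. -/
theorem add_smul_eq_add_smul_iff {e v w : V} (he : e ≠ 0) (hv : ⟪e, v⟫ = 0)
    (hw : ⟪e, w⟫ = 0) {s t : ℝ} : v + s • e = w + t • e ↔ v = w ∧ s = t := by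
  refine ⟨fun h => ?_, fun ⟨h₁, h₂⟩ => by rw [h₁, h₂]⟩
  have h1 := congrArg (fun x => ⟪e, x⟫) h
  have h2 : ‖e‖ ^ 2 ≠ 0 := pow_ne_zero _ (norm_ne_zero_iff.2 he)
  simp only [inner_add_right, inner_smul_right, hv, hw, zero_add,
    real_inner_self_eq_norm_sq] at h1
  have h3 := mul_right_cancel₀ h2 h1
  subst h3
  exact ⟨add_right_cancel h, rfl⟩

theorem inner_add_smul_add_smul {e v w : V} (hv : ⟪e, v⟫ = 0) (hw : ⟪e, w⟫ = 0) (s t : ℝ) :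
    ⟪v + s • e, w + t • e⟫ = ⟪v, w⟫ + s * t * ‖e‖ ^ 2 := by
  have hv' : ⟪v, e⟫ = 0 := by rw [real_inner_comm, hv]
  simp only [inner_add_left, inner_add_right, inner_smul_left, inner_smul_right, hw, hv',
    real_inner_self_eq_norm_sq, conj_trivial]
  ring

namespace IsCircularCone

variable {e : V} {Q : Set V}

/-- The projection onto the cone of a point outside the cone and its polar. -/
theorem proj_of_abs_lt (hQ : IsCircularCone e Q) (he : e ≠ 0) {w : V} {t : ℝ} (hw : ⟪e, w⟫ = 0)
    (ht : |t| * ‖e‖ < ‖w‖) :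
    ∃ l : ℝ, 0 < l ∧ l < 1 ∧ l • w + (l * (‖w‖ / ‖e‖)) • e ∈ Q ∧
      ∀ k ∈ Q, ⟪w + t • e - (l • w + (l * (‖w‖ / ‖e‖)) • e),
        k - (l • w + (l * (‖w‖ / ‖e‖)) • e)⟫ ≤ 0 := by
  have he0 : 0 < ‖e‖ := norm_pos_iff.2 he
  have hw0 : 0 < ‖w‖ := lt_of_le_of_lt (by positivity) ht
  have ht1 : t * ‖e‖ < ‖w‖ := lt_of_le_of_lt (by gcongr; exact le_abs_self t) ht
  have ht2 : -t * ‖e‖ < ‖w‖ := lt_of_le_of_lt (by gcongr; exact neg_le_abs t) ht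
  -- The foot of the perpendicular on the boundary ray through `w + (‖w‖ / ‖e‖) • e`.
  set l : ℝ := (‖w‖ + t * ‖e‖) / (2 * ‖w‖) with hl
  have hl0 : 0 < l := div_pos (by linarith) (by positivity)
  have hl1 : l < 1 := by rw [hl, div_lt_one (by positivity)]; linarith
  have hlw : ⟪e, l • w⟫ = 0 := by rw [inner_smul_right, hw, mul_zero]
  refine ⟨l, hl0, hl1, (hQ _ _ hlw).2 ?_, ?_⟩
  · rw [norm_smul, Real.norm_of_nonneg hl0.le, mul_assoc, div_mul_cancel₀ _ he0.ne']
  · intro k hk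
    obtain ⟨v, s, hv, rfl⟩ := exists_eq_add_smul he k
    have hvs := (hQ _ _ hv).1 hk
    have e1 : w + t • e - (l • w + (l * (‖w‖ / ‖e‖)) • e)
        = (1 - l) • w + (-((1 - l) * (‖w‖ / ‖e‖))) • e := by
      have : t = l * (‖w‖ / ‖e‖) + -((1 - l) * (‖w‖ / ‖e‖)) := by
        rw [hl]; field_simp; ring
      nth_rewrite 1 [this]
      module
    have e2 : v + s • e - (l • w + (l * (‖w‖ / ‖e‖)) • e)
        = (v - l • w) + (s - l * (‖w‖ / ‖e‖)) • e := by module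
    rw [e1, e2, inner_add_smul_add_smul (by rw [inner_smul_right, hw, mul_zero])
      (by rw [inner_sub_right, hv, hlw, sub_zero]), inner_smul_left, inner_sub_right,
      inner_smul_right, real_inner_self_eq_norm_sq, conj_trivial]
    -- The residual is orthogonal to the projected point, so only its product with `k` survives.
    have e3 : (1 - l) * (⟪w, v⟫ - l * ‖w‖ ^ 2)
        + -((1 - l) * (‖w‖ / ‖e‖)) * (s - l * (‖w‖ / ‖e‖)) * ‖e‖ ^ 2
        = (1 - l) * (⟪w, v⟫ - ‖w‖ * (s * ‖e‖)) := by field_simp; ring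
    rw [e3]
    have h1 : ⟪w, v⟫ ≤ ‖w‖ * (s * ‖e‖) := (real_inner_le_norm w v).trans (by gcongr)
    exact mul_nonpos_of_nonneg_of_nonpos (by linarith) (by linarith)

/-- The projection onto the cone shrinks the component orthogonal to the axis. -/
theorem exists_proj (hQ : IsCircularCone e Q) (he : e ≠ 0) (z : V) :
    ∃ (l s : ℝ), 0 ≤ l ∧ l ≤ 1 ∧ l • z + s • e ∈ Q ∧
      ∀ k ∈ Q, ⟪z - (l • z + s • e), k - (l • z + s • e)⟫ ≤ 0 := by
  obtain ⟨w, t, hw, rfl⟩ := exists_eq_add_smul he z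
  rcases lt_or_ge (|t| * ‖e‖) ‖w‖ with h | h
  · obtain ⟨l, hl0, hl1, hm, hk⟩ := hQ.proj_of_abs_lt he hw h
    refine ⟨l, l * (‖w‖ / ‖e‖) - l * t, hl0.le, hl1.le, ?_⟩
    rw [show l • (w + t • e) + (l * (‖w‖ / ‖e‖) - l * t) • e
      = l • w + (l * (‖w‖ / ‖e‖)) • e by module]
    exact ⟨hm, hk⟩
  -- The remaining points lie in the cone and are fixed, or in its polar and go to `0`.
  rcases le_or_gt 0 t with h0 | h0
  · refine ⟨1, 0, zero_le_one, le_rfl, ?_, ?_⟩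
    · rw [one_smul, zero_smul, add_zero, hQ _ _ hw]
      rwa [abs_of_nonneg h0] at h
    · simp
  · refine ⟨0, 0, le_rfl, zero_le_one, ?_, ?_⟩
    · have := (hQ 0 0 (inner_zero_right _)).2 (by simp)
      simpa using this
    · intro k hk
      obtain ⟨v, s, hv, rfl⟩ := exists_eq_add_smul he k
      have hvs := (hQ _ _ hv).1 hk
      rw [abs_of_neg h0] at h
      simp only [zero_smul, add_zero, sub_zero]
      rw [inner_add_smul_add_smul hw hv]
      have h1 : ⟪w, v⟫ ≤ (-t * ‖e‖) * (s * ‖e‖) :=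
        (real_inner_le_norm w v).trans
          (mul_le_mul h hvs (norm_nonneg _) ((norm_nonneg _).trans h))
      nlinarith

/-- Convex sets that are invariant under translations along the axis are lattice-like. -/
theorem isLatticeLike_of_add_smul_mem (hQ : IsCircularCone e Q) (he : e ≠ 0) {M : Set V}
    (hM : Convex ℝ M) (h : ∀ x ∈ M, ∀ t : ℝ, x + t • e ∈ M) : IsLatticeLike Q M := by
  intro x hx y hy
  constructor
  · obtain ⟨l, s, h0, h1, hm, hk⟩ := hQ.exists_proj he (x - y)
    rw [conicInf_eq_sub hm hk]
    have := h _ (hM hx hy (sub_nonneg.2 h1) h0 (by ring)) (-s)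
    convert this using 1
    module
  · obtain ⟨l, s, h0, h1, hm, hk⟩ := hQ.exists_proj he (y - x)
    rw [conicSup_eq_add hm hk]
    have := h _ (hM hx hy (sub_nonneg.2 h1) h0 (by ring)) s
    convert this using 1
    module

end IsCircularCone

/-! ### Touching balls and invariance along the axis. -/

/-- Moving from a boundary point of a ball in a direction pointing into the ball, one stays
inside the ball for a short time. -/
theorem exists_add_smul_mem_ball {c p z : V} (hz : ⟪p - c, z⟫ < 0) :
    ∃ s : ℝ, 0 < s ∧ p + s • z ∈ Metric.ball c ‖p - c‖ := by
  have hz0 : z ≠ 0 := by rintro rfl; simp at hz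
  have hz1 : 0 < ‖z‖ := norm_pos_iff.2 hz0
  -- This `s` minimizes the distance from `p + s • z` to `c`.
  refine ⟨-⟪p - c, z⟫ / ‖z‖ ^ 2, div_pos (by linarith) (by positivity), ?_⟩
  set s := -⟪p - c, z⟫ / ‖z‖ ^ 2 with hs
  have hs0 : 0 < s := div_pos (by linarith) (by positivity)
  rw [Metric.mem_ball, dist_eq_norm, show p + s • z - c = (p - c) + s • z by abel]
  refine lt_of_pow_lt_pow_left₀ 2 (norm_nonneg _) ?_
  rw [norm_add_sq_real, inner_smul_right, norm_smul, mul_pow, Real.norm_eq_abs, sq_abs]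
  have : s * ‖z‖ ^ 2 = -⟪p - c, z⟫ := by rw [hs]; field_simp
  nlinarith [mul_pos hs0 (neg_pos.2 hz)]

/-- A ball in a convex set that touches the boundary determines a supporting hyperplane. -/
theorem inner_sub_le_zero_of_ball_subset {M : Set V} (hM : Convex ℝ M) {c p : V}
    (hB : Metric.ball c ‖p - c‖ ⊆ M) (hp : p ∉ interior M) {m : V} (hm : m ∈ M) :
    ⟪p - c, m - p⟫ ≤ 0 := by
  by_contra! h
  -- Prolonging the segment from `m` beyond `p` enters the ball, so `p` lies strictly between `m`
  -- and an interior point.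
  obtain ⟨s, hs, hsm⟩ := exists_add_smul_mem_ball (c := c) (p := p) (z := -(m - p))
    (by rw [inner_neg_right]; linarith)
  have hint : p + s • -(m - p) ∈ interior M := interior_maximal hB Metric.isOpen_ball hsm
  refine hp (hM.openSegment_interior_self_subset_interior hint hm ?_)
  refine ⟨1 / (1 + s), s / (1 + s), by positivity, by positivity, by field_simp, ?_⟩
  have h1 : (1 + s) ≠ 0 := by positivity
  have : (1 + s) • ((1 / (1 + s)) • (p + s • -(m - p)) + (s / (1 + s)) • m) = (1 + s) • p := by
    rw [smul_add, smul_smul, smul_smul, mul_div_cancel₀ _ h1, mul_div_cancel₀ _ h1]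
    module
  exact smul_right_injective V h1 this

namespace IsCircularCone

variable {e : V} {Q : Set V}

/-- Balls inside a lattice-like convex set touch its boundary orthogonally to the axis. -/
theorem inner_axis_eq_zero (hQ : IsCircularCone e Q) (he : e ≠ 0)
    (hdim : ∀ x : V, ∃ y ≠ 0, ⟪e, y⟫ = 0 ∧ ⟪x, y⟫ = 0) {M : Set V} (hM : Convex ℝ M)
    (hL : IsLatticeLike Q M) {c p : V} (hB : Metric.ball c ‖p - c‖ ⊆ M) (hpM : p ∈ M)
    (hp : p ∉ interior M) : ⟪p - c, e⟫ = 0 := by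
  have he0 : 0 < ‖e‖ := norm_pos_iff.2 he
  obtain ⟨w, hw0, hew, haw⟩ := hdim (p - c)
  have hw1 : 0 < ‖w‖ := norm_pos_iff.2 hw0
  -- Small enough that `w ± t • e` lie outside both the cone and its polar.
  set t : ℝ := ‖w‖ / (2 * ‖e‖) with ht
  have ht0 : 0 < t := by positivity
  have hte : t * ‖e‖ < ‖w‖ := by
    have : t * ‖e‖ = ‖w‖ / 2 := by rw [ht]; field_simp
    linarith
  rcases lt_trichotomy ⟪p - c, e⟫ 0 with h | h | h
  -- The lower operation at `p` subtracts a multiple of `w`, which is tangent to the ball, and a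
  -- positive multiple of `e`; this crosses the supporting hyperplane. The case of positive sign
  -- uses the upper operation.
  · exfalso
    obtain ⟨s, hs, hsm⟩ := exists_add_smul_mem_ball (c := c) (p := p) (z := w + t • e)
      (by rw [inner_add_right, haw, inner_smul_right]; nlinarith)
    have hsw : ⟪e, -(s • w)⟫ = 0 := by rw [inner_neg_right, inner_smul_right, hew]; simp
    have hst : |-(s * t)| * ‖e‖ < ‖-(s • w)‖ := by
      rw [norm_neg, norm_smul, Real.norm_of_nonneg hs.le, abs_neg, abs_of_pos (mul_pos hs ht0),
        mul_assoc]
      gcongr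
    obtain ⟨l, hl0, -, hm, hk⟩ := hQ.proj_of_abs_lt he hsw hst
    have h1 := (hL p hpM _ (hB hsm)).1
    rw [conicInf_eq_sub hm (by
      rwa [show p - (p + s • (w + t • e)) = -(s • w) + (-(s * t)) • e by module])] at h1
    have h2 := inner_sub_le_zero_of_ball_subset hM hB hp h1
    have hpos : 0 < l * (‖-(s • w)‖ / ‖e‖) := by
      rw [norm_neg, norm_smul, Real.norm_of_nonneg hs.le]; positivity
    rw [sub_sub_cancel_left, inner_neg_right, inner_add_right, inner_smul_right, inner_neg_right,
      inner_smul_right, haw, inner_smul_right] at h2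
    nlinarith
  · exact h
  · exfalso
    obtain ⟨s, hs, hsm⟩ := exists_add_smul_mem_ball (c := c) (p := p) (z := w + (-t) • e)
      (by rw [inner_add_right, haw, inner_smul_right]; nlinarith)
    have hsw : ⟪e, s • w⟫ = 0 := by rw [inner_smul_right, hew]; simp
    have hst : |-(s * t)| * ‖e‖ < ‖s • w‖ := by
      rw [norm_smul, Real.norm_of_nonneg hs.le, abs_neg, abs_of_pos (mul_pos hs ht0),
        mul_assoc]
      gcongr
    obtain ⟨l, hl0, -, hm, hk⟩ := hQ.proj_of_abs_lt he hsw hst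
    have h1 := (hL p hpM _ (hB hsm)).2
    rw [conicSup_eq_add hm (by
      rwa [show p + s • (w + (-t) • e) - p = s • w + (-(s * t)) • e by module])] at h1
    have h2 := inner_sub_le_zero_of_ball_subset hM hB hp h1
    have hpos : 0 < l * (‖s • w‖ / ‖e‖) := by
      rw [norm_smul, Real.norm_of_nonneg hs.le]; positivity
    rw [add_sub_cancel_left, inner_add_right, inner_smul_right,
      inner_smul_right, haw, inner_smul_right] at h2
    nlinarith

end IsCircularCone

/-- A real function with `|f t - f s| ≤ C (t - s) ^ 2` is constant. -/
theorem eq_of_forall_sub_le_mul_sq {f : ℝ → ℝ} {C : ℝ}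
    (h : ∀ s t, f t - f s ≤ C * (t - s) ^ 2) (s t : ℝ) : f s = f t := by
  have hd : ∀ x, HasDerivAt f 0 x := by
    intro x
    rw [hasDerivAt_iff_isLittleO]
    have h1 : (fun y => f y - f x - (y - x) • (0 : ℝ)) =O[nhds x] fun y => ‖y - x‖ ^ 2 := by
      refine Asymptotics.IsBigO.of_bound C (Filter.Eventually.of_forall fun y => ?_)
      rw [smul_zero, sub_zero, Real.norm_eq_abs, Real.norm_eq_abs, Real.norm_eq_abs, sq_abs,
        abs_of_nonneg (sq_nonneg (y - x)), abs_le]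
      constructor
      · linarith [h y x, show C * (x - y) ^ 2 = C * (y - x) ^ 2 by ring]
      · exact h x y
    exact h1.trans_isLittleO (Asymptotics.isLittleO_pow_sub_sub x one_lt_two)
  exact is_const_of_deriv_eq_zero (fun x => (hd x).differentiableAt) (fun x => (hd x).deriv) s t

/-- If all balls inside a closed set touch its boundary orthogonally to `e`, then the interior is
invariant under translations along `e`. -/
theorem interior_add_smul_mem [FiniteDimensional ℝ V] {e : V} {M : Set V} (hcl : IsClosed M)
    (H : ∀ c p, Metric.ball c ‖p - c‖ ⊆ M → p ∈ M → p ∉ interior M → ⟪p - c, e⟫ = 0)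
    {x : V} (hx : x ∈ interior M) (t : ℝ) : x + t • e ∈ interior M := by
  rcases eq_or_ne M Set.univ with rfl | hne
  · simp
  have hMc : (Mᶜ).Nonempty := Set.nonempty_compl.2 hne
  have hcc : (closure Mᶜ).Nonempty := hMc.closure
  set g : ℝ → ℝ := fun t => Metric.infDist (x + t • e) Mᶜ with hg
  have hmem : ∀ y, y ∈ interior M ↔ 0 < Metric.infDist y Mᶜ := by
    intro y
    rw [← not_iff_not, not_lt, ← Set.mem_compl_iff, ← closure_compl,
      Metric.mem_closure_iff_infDist_zero hMc]
    exact ⟨fun h => h.le, fun h => le_antisymm h Metric.infDist_nonneg⟩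
  -- The point of `closure Mᶜ` nearest to `x + s • e` is a competitor for the distance at `t`, and
  -- orthogonality reduces the estimate to Pythagoras.
  have key : ∀ s t, g t ^ 2 - g s ^ 2 ≤ ‖e‖ ^ 2 * (t - s) ^ 2 := by
    intro s t
    set c := x + s • e with hc
    obtain ⟨p, hp, hpd⟩ := isClosed_closure.exists_infDist_eq_dist hcc c
    rw [Metric.infDist_closure, dist_comm, dist_eq_norm] at hpd
    have hp1 : p ∉ interior M := by rwa [closure_compl] at hp
    have hgs : g s = ‖p - c‖ := hpd
    have hgt : g t ≤ ‖x + t • e - p‖ := by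
      rw [← dist_eq_norm]
      exact (Metric.infDist_closure (s := Mᶜ)).symm.trans_le (Metric.infDist_le_dist_of_mem hp)
    have horth : ⟪p - c, e⟫ = 0 := by
      rcases eq_or_ne p c with rfl | hpc
      · simp
      have hB : Metric.ball c ‖p - c‖ ⊆ M := by
        rw [← hpd]
        intro y hy
        by_contra hyM
        have h1 : Metric.infDist c Mᶜ ≤ dist c y := Metric.infDist_le_dist_of_mem hyM
        rw [Metric.mem_ball, dist_comm] at hy
        exact absurd hy (not_lt.2 h1)
      refine H c p hB ?_ hp1
      have h2 : p ∈ closure (Metric.ball c ‖p - c‖) := by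
        rw [closure_ball _ (norm_ne_zero_iff.2 (sub_ne_zero.2 hpc)), Metric.mem_closedBall,
          dist_eq_norm]
      exact hcl.closure_subset_iff.2 hB h2
    have hsq : ‖x + t • e - p‖ ^ 2 = ‖p - c‖ ^ 2 + ‖e‖ ^ 2 * (t - s) ^ 2 := by
      rw [show x + t • e - p = (t - s) • e - (p - c) by rw [hc]; module, norm_sub_sq_real,
        inner_smul_left, real_inner_comm, horth, norm_smul, mul_pow, Real.norm_eq_abs, sq_abs]
      ring
    have := pow_le_pow_left₀ Metric.infDist_nonneg hgt 2
    rw [hgs]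
    linarith
  have hconst := eq_of_forall_sub_le_mul_sq key 0 t
  rw [hmem] at hx ⊢
  have h0 : 0 < g 0 := by simpa [hg] using hx
  have h1 : 0 ≤ g t := Metric.infDist_nonneg
  have h2 : g t = g 0 := (sq_eq_sq₀ h1 h0.le).1 hconst.symm
  exact h0.trans_eq h2.symm

/-- The lattice-like convex bodies of a circular cone are the convex bodies which are invariant
under translations along its axis. -/
theorem IsCircularCone.isLatticeLike_iff [FiniteDimensional ℝ V] {e : V} {Q : Set V}
    (hQ : IsCircularCone e Q) (he : e ≠ 0)
    (hdim : ∀ x : V, ∃ y ≠ 0, ⟪e, y⟫ = 0 ∧ ⟪x, y⟫ = 0) {M : Set V} (hcl : IsClosed M)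
    (hM : Convex ℝ M) (hint : (interior M).Nonempty) :
    IsLatticeLike Q M ↔ ∀ x ∈ M, ∀ t : ℝ, x + t • e ∈ M := by
  refine ⟨fun hL x hx t => ?_, hQ.isLatticeLike_of_add_smul_mem he hM⟩
  have h1 : M = closure (interior M) := by
    rw [hM.closure_interior_eq_closure_of_nonempty_interior hint, hcl.closure_eq]
  have hcont : Continuous fun y : V => y + t • e := by fun_prop
  have hmaps : Set.MapsTo (fun y : V => y + t • e) (interior M) (interior M) := fun y hy =>
    interior_add_smul_mem hcl
      (fun c p hB hpM hp => hQ.inner_axis_eq_zero he hdim hM hL hB hpM hp) hy t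
  rw [h1] at hx ⊢
  exact hmaps.closure hcont hx

/-! ### Countable halfspace representations. -/

/-- A closed convex set which is invariant under translations along `e` is the intersection of
countably many halfspaces with normals orthogonal to `e`, of any prescribed length. -/
theorem exists_eq_iInter_lowerHalfspace [FiniteDimensional ℝ V] {e : V} {M : Set V}
    (hcl : IsClosed M) (hM : Convex ℝ M) (hne : M.Nonempty)
    (h : ∀ x ∈ M, ∀ t : ℝ, x + t • e ∈ M) {r : ℝ} (hr : 0 < r) :
    ∃ (I : Set ℕ) (u a : ℕ → V), (∀ i ∈ I, ⟪e, a i⟫ = 0 ∧ ‖a i‖ = r) ∧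
      M = ⋂ i ∈ I, lowerHalfspace (u i) (a i) := by
  have sep : ∀ x : (Mᶜ : Set V), ∃ u a : V, ⟪e, a⟫ = 0 ∧ ‖a‖ = r ∧ M ⊆ lowerHalfspace u a ∧
      (x : V) ∉ lowerHalfspace u a := by
    rintro ⟨x, hx⟩
    obtain ⟨p, hp, hmin⟩ := exists_norm_eq_iInf_of_complete_convex hne hcl.isComplete hM x
    have hin := (norm_eq_iInf_iff_real_inner_le_zero hM hp).1 hmin
    have hxp : 0 < ‖x - p‖ := norm_pos_iff.2 (sub_ne_zero.2 fun hxp => hx (hxp ▸ hp))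
    have hrx : 0 < r / ‖x - p‖ := div_pos hr hxp
    refine ⟨p, (r / ‖x - p‖) • (x - p), ?_, ?_, ?_, ?_⟩
    -- Testing the variational inequality at `p + e` and `p - e` kills the axial component of the
    -- normal.
    · have h1 := hin _ (h p hp 1)
      have h2 := hin _ (h p hp (-1))
      rw [add_sub_cancel_left, inner_smul_right] at h1 h2
      rw [inner_smul_right, real_inner_comm, show ⟪x - p, e⟫ = 0 by linarith, mul_zero]
    · rw [norm_smul, Real.norm_of_nonneg hrx.le, div_mul_cancel₀ _ hxp.ne']
    · intro m hm
      have h1 := hin m hm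
      rw [inner_sub_right] at h1
      simp only [lowerHalfspace, Set.mem_ofPred_eq, inner_smul_left, conj_trivial]
      exact mul_le_mul_of_nonneg_left (by linarith) hrx.le
    · simp only [lowerHalfspace, Set.mem_ofPred_eq, inner_smul_left, conj_trivial, not_le]
      refine mul_lt_mul_of_pos_left ?_ hrx
      have h1 : 0 < ⟪x - p, x - p⟫ := by rw [real_inner_self_eq_norm_sq]; positivity
      rw [inner_sub_right] at h1
      linarith
  choose u a h1 h2 h3 h4 using sep
  have hopen : ∀ x, IsOpen (lowerHalfspace (u x) (a x))ᶜ := fun x =>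
    (isClosed_le (by fun_prop) (by fun_prop) : IsClosed (lowerHalfspace (u x) (a x))).isOpen_compl
  -- Lindelöf: countably many of the open complements already cover `Mᶜ`.
  obtain ⟨T, hT, hTe⟩ := TopologicalSpace.isOpen_iUnion_countable _ hopen
  have hMT : M = ⋂ x ∈ T, lowerHalfspace (u x) (a x) := by
    refine Set.Subset.antisymm (Set.subset_iInter₂ fun x _ => h3 x) fun y hy => ?_
    by_contra hyM
    have : y ∈ ⋃ x, (lowerHalfspace (u x) (a x))ᶜ := Set.mem_iUnion.2 ⟨⟨y, hyM⟩, h4 ⟨y, hyM⟩⟩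
    rw [← hTe] at this
    obtain ⟨x, hxT, hx⟩ := Set.mem_iUnion₂.1 this
    exact hx (Set.mem_iInter₂.1 hy x hxT)
  rcases T.eq_empty_or_nonempty with rfl | hTn
  · exact ⟨∅, fun _ => 0, fun _ => 0, by simp, by simpa using hMT⟩
  · obtain ⟨f, rfl⟩ := hT.exists_eq_range hTn
    exact ⟨Set.univ, fun n => u (f n), fun n => a (f n), fun n _ => ⟨h1 _, h2 _⟩,
      by simpa using hMT⟩

end CircularCone

/-! ### Rank-two algebras as spin factors. -/

namespace EuclideanJordanAlgebra

variable {V : Type*} [NormedAddCommGroup V] [InnerProductSpace ℝ V]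
  (J : EuclideanJordanAlgebra V)

theorem mul_one (x : V) : J.mul x J.one = x := by
  rw [J.mul_comm, J.one_mul]

theorem one_ne_zero [Nontrivial V] : J.one ≠ 0 := by
  intro h
  obtain ⟨x, hx⟩ := exists_ne (0 : V)
  apply hx
  rw [← J.one_mul x, h]
  simp

theorem inner_mul_self_one (x : V) : ⟪J.mul x x, J.one⟫ = ‖x‖ ^ 2 := by
  rw [J.inner_mul, J.mul_one, real_inner_self_eq_norm_sq]

theorem pow_zero (x : V) : J.pow x 0 = J.one := rfl

theorem pow_one (x : V) : J.pow x 1 = x := J.mul_one x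

theorem pow_two (x : V) : J.pow x 2 = J.mul x x := by
  change J.mul x (J.pow x 1) = _
  rw [pow_one]

theorem degree_le {x : V} {k : ℕ} (hk : 0 < k)
    (h : ¬ LinearIndependent ℝ fun i : Fin (k + 1) => J.pow x i) : J.degree x ≤ k :=
  Nat.sInf_le ⟨hk, h⟩

/-- A quadratic equation for `x` bounds the degree by two. -/
theorem degree_le_two {x : V} {a b : ℝ} (h : J.mul x x = a • x + b • J.one) :
    J.degree x ≤ 2 := by
  refine J.degree_le two_pos (Fintype.not_linearIndependent_iff.2 ⟨![-b, -a, 1], ?_, 2, by simp⟩)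
  refine (Fin.sum_univ_three _).trans ?_
  change (-b) • J.pow x 0 + (-a) • J.pow x 1 + (1 : ℝ) • J.pow x 2 = 0
  rw [pow_zero, pow_one, pow_two, h]
  module

theorem degree_smul_one_le (l : ℝ) : J.degree (l • J.one) ≤ 1 := by
  refine J.degree_le one_pos (Fintype.not_linearIndependent_iff.2 ⟨![-l, 1], ?_, 1, by simp⟩)
  refine (Fin.sum_univ_two _).trans ?_
  change (-l) • J.pow _ 0 + (1 : ℝ) • J.pow _ 1 = 0
  rw [pow_zero, pow_one]
  module

section FiniteDimensional

variable [FiniteDimensional ℝ V]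

theorem not_linearIndependent_pow (x : V) :
    ¬ LinearIndependent ℝ fun i : Fin (Module.finrank ℝ V + 1 + 1) => J.pow x i := by
  intro h
  have := h.fintype_card_le_finrank
  simp only [Fintype.card_fin] at this
  omega

theorem bddAbove_range_degree : BddAbove (Set.range J.degree) := by
  refine ⟨Module.finrank ℝ V + 1, ?_⟩
  rintro _ ⟨x, rfl⟩
  exact J.degree_le (Nat.succ_pos _) (J.not_linearIndependent_pow x)

/-- The dimension count makes the defining set nonempty, so the infimum is attained and is not the
default `0`. -/
theorem degree_spec (x : V) : 0 < J.degree x ∧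
    ¬ LinearIndependent ℝ fun i : Fin (J.degree x + 1) => J.pow x i :=
  Nat.sInf_mem (s := {k | 0 < k ∧ ¬ LinearIndependent ℝ fun i : Fin (k + 1) => J.pow x i})
    ⟨_, Nat.succ_pos _, J.not_linearIndependent_pow x⟩

theorem degree_le_rank (x : V) : J.degree x ≤ J.rank :=
  le_csSup J.bddAbove_range_degree ⟨x, rfl⟩

/-- In an algebra of rank two each element satisfies a quadratic equation. -/
theorem exists_mul_self_eq (hr : J.rank = 2) (x : V) :
    ∃ a b : ℝ, J.mul x x = a • x + b • J.one := by
  have h3 : ¬ LinearIndependent ℝ fun i : Fin 3 => J.pow x i := by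
    intro h
    have hle : J.degree x + 1 ≤ 3 := by have := J.degree_le_rank x; omega
    exact (J.degree_spec x).2 (h.comp (Fin.castLE hle) (Fin.castLE_injective hle))
  obtain ⟨g, hg, i, hi⟩ := Fintype.not_linearIndependent_iff.1 h3
  simp only [Fin.sum_univ_three, Fin.val_zero, Fin.val_one, Fin.val_two, pow_zero, pow_one,
    pow_two] at hg
  by_cases h2 : g 2 = 0
  · by_cases h1 : g 1 = 0
    · have h0 : g 0 ≠ 0 := by
        intro h0
        fin_cases i
        exacts [hi h0, hi h1, hi h2]
      have he : J.one = 0 := by simpa [h1, h2, h0] using hg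
      have hx : x = 0 := by rw [← J.one_mul x, he]; simp
      exact ⟨0, 0, by simp [hx]⟩
    · have hx : x = (-(g 0 / g 1)) • J.one := by
        have : x = (-(g 0 / g 1)) • J.one + (1 / g 1) • (g 0 • J.one + g 1 • x) := by
          rw [smul_add, smul_smul, smul_smul, one_div_mul_cancel h1]
          module
        rw [h2, zero_smul, add_zero] at hg
        rwa [hg, smul_zero, add_zero] at this
      refine ⟨-(g 0 / g 1), 0, ?_⟩
      nth_rewrite 1 [hx]
      rw [map_smul, LinearMap.smul_apply, J.one_mul, zero_smul, add_zero]
  · refine ⟨-(g 1 / g 2), -(g 0 / g 2), ?_⟩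
    have : J.mul x x = (-(g 1 / g 2)) • x + (-(g 0 / g 2)) • J.one
        + (1 / g 2) • (g 0 • J.one + g 1 • x + g 2 • J.mul x x) := by
      rw [smul_add, smul_smul _ (g 2), one_div_mul_cancel h2]
      module
    rwa [hg, smul_zero, add_zero] at this

/-- The rank is attained as a degree, while multiples of the unit have degree at most one. -/
theorem exists_ne_smul_one (hr : J.rank = 2) : ∃ x : V, ∀ l : ℝ, x ≠ l • J.one := by
  have hmem : J.rank ∈ Set.range J.degree :=
    Nat.sSup_mem ⟨_, 0, rfl⟩ J.bddAbove_range_degree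
  obtain ⟨x, hx⟩ := hmem
  refine ⟨x, fun l hl => ?_⟩
  have := J.degree_smul_one_le l
  rw [← hl] at this
  omega

/-- A simple algebra of rank two has dimension at least three. -/
theorem exists_orthogonal (hs : J.IsSimple) (hr : J.rank = 2) (x : V) :
    ∃ y ≠ 0, ⟪J.one, y⟫ = 0 ∧ ⟪x, y⟫ = 0 := by
  have := hs.1
  have he : J.one ≠ 0 := J.one_ne_zero
  by_contra! H
  obtain ⟨w, t, hw, rfl⟩ := exists_eq_add_smul he x
  rcases eq_or_ne w 0 with rfl | hw0
  · obtain ⟨z, hz⟩ := J.exists_ne_smul_one hr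
    obtain ⟨v, s, hv, rfl⟩ := exists_eq_add_smul he z
    refine H v ?_ hv (by rw [zero_add, inner_smul_left, hv, mul_zero])
    rintro rfl
    exact hz s (zero_add _)
  have hwn : 0 < ‖w‖ := norm_pos_iff.2 hw0
  have hen : 0 < ‖J.one‖ := norm_pos_iff.2 he
  have hwe : ⟪w, J.one⟫ = 0 := by rw [real_inner_comm, hw]
  have hspan : ∀ y, ∃ a b : ℝ, y = a • w + b • J.one := by
    intro y
    obtain ⟨v, s, hv, rfl⟩ := exists_eq_add_smul he y
    refine ⟨⟪w, v⟫ / ‖w‖ ^ 2, s, ?_⟩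
    have h1 : ⟪J.one, v - (⟪w, v⟫ / ‖w‖ ^ 2) • w⟫ = 0 := by
      rw [inner_sub_right, inner_smul_right, hv, hw]; simp
    have h2 : ⟪w, v - (⟪w, v⟫ / ‖w‖ ^ 2) • w⟫ = 0 := by
      rw [inner_sub_right, inner_smul_right, real_inner_self_eq_norm_sq]
      field_simp
      ring
    by_contra hne
    refine H _ ?_ h1 (by rw [inner_add_left, inner_smul_left, h1, h2]; simp)
    intro h0
    exact hne (by rw [← sub_eq_zero.1 h0])
  obtain ⟨a, b, hab⟩ := J.exists_mul_self_eq hr w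
  have hb : 0 < b := by
    have := J.inner_mul_self_one w
    rw [hab, inner_add_left, inner_smul_left, inner_smul_left, hwe, real_inner_self_eq_norm_sq,
      mul_zero, zero_add, conj_trivial] at this
    have h1 : 0 < b * ‖J.one‖ ^ 2 := by rw [this]; positivity
    exact pos_of_mul_pos_left h1 (by positivity)
  -- With this `r`, `w + r • e` is an eigenvector of multiplication by `w`. Since `w` and `e` span,
  -- its line is a nonzero proper ideal, contradicting simplicity.
  obtain ⟨r, hr⟩ : ∃ r : ℝ, b = r * (a + r) := by
    refine ⟨(-a + √(a ^ 2 + 4 * b)) / 2, ?_⟩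
    have := Real.sq_sqrt (show 0 ≤ a ^ 2 + 4 * b by positivity)
    linarith
  have hideal : ∀ y, ∀ z ∈ Submodule.span ℝ {w + r • J.one},
      J.mul y z ∈ Submodule.span ℝ {w + r • J.one} := by
    intro y z hz
    obtain ⟨k, rfl⟩ := Submodule.mem_span_singleton.1 hz
    obtain ⟨p, q, rfl⟩ := hspan y
    refine Submodule.mem_span_singleton.2 ⟨k * (p * (a + r) + q), ?_⟩
    simp only [map_add, map_smul, LinearMap.add_apply, LinearMap.smul_apply, J.one_mul,
      J.mul_one, hab, hr]
    module
  have hin : ∀ k : ℝ, ⟪w, k • (w + r • J.one)⟫ = k * ‖w‖ ^ 2 := by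
    intro k
    rw [inner_smul_right, inner_add_right, inner_smul_right, hwe, real_inner_self_eq_norm_sq]
    ring
  rcases hs.2 _ hideal with h | h
  · rw [Submodule.span_singleton_eq_bot] at h
    have := hin 1
    rw [h, smul_zero, inner_zero_right, _root_.one_mul] at this
    exact (pow_pos hwn 2).ne this
  · have h1 : J.one ∈ Submodule.span ℝ {w + r • J.one} := h ▸ Submodule.mem_top
    obtain ⟨k, hk⟩ := Submodule.mem_span_singleton.1 h1
    have h2 := hin k
    rw [hk, hwe] at h2
    have hk0 : k = 0 := by
      rcases mul_eq_zero.1 h2.symm with h3 | h3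
      · exact h3
      · exact absurd h3 (by positivity)
    rw [hk0, zero_smul] at hk
    exact he hk.symm

end FiniteDimensional

/-- The elements orthogonal to the unit square to multiples of the unit, as in a spin factor. -/
def IsSpin : Prop :=
  ∀ w, ⟪J.one, w⟫ = 0 → J.mul w w = (‖w‖ ^ 2 / ‖J.one‖ ^ 2) • J.one

/-- A simple algebra of rank two is a spin factor. -/
theorem isSpin [FiniteDimensional ℝ V] (hs : J.IsSimple) (hr : J.rank = 2) : J.IsSpin := by
  intro w hw
  have := hs.1
  have he : J.one ≠ 0 := J.one_ne_zero
  have hen : ‖J.one‖ ≠ 0 := norm_ne_zero_iff.2 he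
  rcases eq_or_ne w 0 with rfl | hw0
  · simp
  have hwn : ‖w‖ ^ 2 ≠ 0 := pow_ne_zero _ (norm_ne_zero_iff.2 hw0)
  obtain ⟨y, hy0, hy, hwy⟩ := J.exists_orthogonal hs hr w
  have hyn : ‖y‖ ^ 2 ≠ 0 := pow_ne_zero _ (norm_ne_zero_iff.2 hy0)
  have hyw : ⟪y, w⟫ = 0 := by rw [real_inner_comm, hwy]
  have hwe : ⟪w, J.one⟫ = 0 := by rw [real_inner_comm, hw]
  have hye : ⟪y, J.one⟫ = 0 := by rw [real_inner_comm, hy]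
  obtain ⟨a, b, hab⟩ := J.exists_mul_self_eq hr w
  obtain ⟨a', b', hab'⟩ := J.exists_mul_self_eq hr y
  -- Pairing the quadratic equations of `w + y` and `w - y` with `w` and `y` gives `a' = a` and `a'
  -- = -a`, so the linear term vanishes.
  obtain ⟨a₁, b₁, h₁⟩ := J.exists_mul_self_eq hr (w + y)
  obtain ⟨a₂, b₂, h₂⟩ := J.exists_mul_self_eq hr (w - y)
  have hmw : ⟪w, J.mul w y⟫ = 0 := by
    rw [real_inner_comm, J.inner_mul, hab, inner_add_right, inner_smul_right, inner_smul_right,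
      hyw, hye]
    simp
  have hmy : ⟪y, J.mul w y⟫ = 0 := by
    rw [real_inner_comm, J.mul_comm, J.inner_mul, hab', inner_add_right, inner_smul_right,
      inner_smul_right, hwy, hwe]
    simp
  simp only [map_add, map_sub, LinearMap.add_apply, LinearMap.sub_apply, J.mul_comm y w, hab,
    hab'] at h₁ h₂
  have e₁ := congrArg (fun v => ⟪w, v⟫) h₁
  have e₂ := congrArg (fun v => ⟪y, v⟫) h₁
  have e₃ := congrArg (fun v => ⟪w, v⟫) h₂
  have e₄ := congrArg (fun v => ⟪y, v⟫) h₂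
  simp only [inner_add_right, inner_sub_right, inner_smul_right, hmw, hmy, hwy, hyw, hwe, hye,
    real_inner_self_eq_norm_sq] at e₁ e₂ e₃ e₄
  have f₁ : a = a₁ := mul_right_cancel₀ hwn (by linarith)
  have f₂ : a' = a₁ := mul_right_cancel₀ hyn (by linarith)
  have f₃ : a = a₂ := mul_right_cancel₀ hwn (by linarith)
  have f₄ : a' = -a₂ := mul_right_cancel₀ hyn (by linarith)
  have ha : a = 0 := by linarith
  have hb := J.inner_mul_self_one w
  rw [hab, inner_add_left, inner_smul_left, inner_smul_left, hwe, real_inner_self_eq_norm_sq,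
    mul_zero, zero_add, conj_trivial] at hb
  rw [hab, ha, zero_smul, zero_add, ← hb]
  congr 1
  field_simp

variable {J}

namespace IsSpin

theorem mul_self (h : J.IsSpin) {w : V} (hw : ⟪J.one, w⟫ = 0) (t : ℝ) :
    J.mul (w + t • J.one) (w + t • J.one)
      = (2 * t) • w + (‖w‖ ^ 2 / ‖J.one‖ ^ 2 + t ^ 2) • J.one := by
  simp only [map_add, map_smul, LinearMap.add_apply, LinearMap.smul_apply, J.one_mul,
    J.mul_one, h w hw]
  module

/-- The cone of squares of a spin factor is a circular cone. -/
theorem isCircularCone_squares (h : J.IsSpin) (he : J.one ≠ 0) :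
    IsCircularCone J.one J.squares := by
  intro v t hv
  have hen : 0 < ‖J.one‖ := norm_pos_iff.2 he
  constructor
  · rintro ⟨x, hx⟩
    obtain ⟨w, s, hw, rfl⟩ := exists_eq_add_smul he x
    simp only [h.mul_self hw] at hx
    obtain ⟨rfl, rfl⟩ := (add_smul_eq_add_smul_iff he
      (by rw [inner_smul_right, hw, mul_zero]) hv).1 hx
    rw [norm_smul, Real.norm_eq_abs, abs_mul, abs_two]
    have e1 : (‖w‖ ^ 2 / ‖J.one‖ ^ 2 + s ^ 2) * ‖J.one‖ - 2 * |s| * ‖w‖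
        = (‖w‖ / ‖J.one‖ - |s|) ^ 2 * ‖J.one‖ := by
      rw [← sq_abs s]; field_simp; ring
    have : 0 ≤ (‖w‖ / ‖J.one‖ - |s|) ^ 2 * ‖J.one‖ := by positivity
    linarith
  · intro hvt
    have ht : 0 ≤ t := nonneg_of_mul_nonneg_left ((norm_nonneg _).trans hvt) hen
    rcases ht.eq_or_lt with rfl | ht
    · have : v = 0 := by simpa using hvt
      exact ⟨0, by simp [this]⟩
    set n := ‖v‖ / ‖J.one‖ with hn
    have hn0 : 0 ≤ n := by positivity
    have hnt : n ≤ t := (div_le_iff₀ hen).2 hvt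
    have hd : 0 ≤ t ^ 2 - n ^ 2 := by nlinarith
    -- A square root `(1 / (2 * s)) • v + s • e` needs `s ^ 2 + n ^ 2 / (4 * s ^ 2) = t`; the larger
    -- solution for `s ^ 2` is nonzero.
    set s := √((t + √(t ^ 2 - n ^ 2)) / 2) with hs
    have hs2 : s ^ 2 = (t + √(t ^ 2 - n ^ 2)) / 2 := Real.sq_sqrt (by positivity)
    have hs0 : 0 < s := Real.sqrt_pos.2 (by positivity)
    have hw : ⟪J.one, (1 / (2 * s)) • v⟫ = 0 := by rw [inner_smul_right, hv, mul_zero]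
    refine ⟨(1 / (2 * s)) • v + s • J.one, ?_⟩
    simp only [h.mul_self hw, smul_smul]
    have e1 : 2 * s * (1 / (2 * s)) = 1 := by field_simp
    have e2 : ‖(1 / (2 * s)) • v‖ ^ 2 / ‖J.one‖ ^ 2 = n ^ 2 / (4 * s ^ 2) := by
      rw [norm_smul, Real.norm_of_nonneg (by positivity), hn]; field_simp; ring
    have e3 : n ^ 2 / (4 * s ^ 2) + s ^ 2 = t := by
      have h4 := Real.sq_sqrt hd
      have h5 : n ^ 2 = 4 * s ^ 2 * (t - s ^ 2) := by rw [hs2]; linarith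
      rw [h5]; field_simp; ring
    rw [e1, e2, e3, one_smul]

/-- The unit coefficient of an idempotent. -/
theorem coeff_of_isIdempotent (h : J.IsSpin) (he : J.one ≠ 0) {w : V} {t : ℝ}
    (hw : ⟪J.one, w⟫ = 0) (hc : J.IsIdempotent (w + t • J.one)) :
    w + t • J.one = 0 ∨ t = 1 / 2 ∨ t = 1 := by
  rw [IsIdempotent, h.mul_self hw, add_smul_eq_add_smul_iff he
    (by rw [inner_smul_right, hw, mul_zero]) hw] at hc
  obtain ⟨h1, h2⟩ := hc
  rcases eq_or_ne w 0 with rfl | hw0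
  · have : t * (t - 1) = 0 := by
      rw [norm_zero, zero_pow two_ne_zero, zero_div, zero_add] at h2; linarith
    rcases mul_eq_zero.1 this with h3 | h3
    · left; simp [h3]
    · right; right; linarith
  · right; left
    have : (2 * t - 1) • w = 0 := by rw [sub_smul, h1, one_smul, sub_self]
    rcases smul_eq_zero.1 this with h3 | h3
    · linarith
    · exact absurd h3 hw0

/-- A nonzero idempotent has unit coefficient at least `1 / 2`, so two of them cannot add up to one
with coefficient `1 / 2`. -/
theorem isPrimitive_half (h : J.IsSpin) (he : J.one ≠ 0) {w : V} (hw : ⟪J.one, w⟫ = 0)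
    (hn : ‖w‖ = ‖J.one‖) : J.IsPrimitive ((1 / 2 : ℝ) • w + (1 / 2 : ℝ) • J.one) := by
  have hen : ‖J.one‖ ≠ 0 := norm_ne_zero_iff.2 he
  have hw' : ∀ a : ℝ, ⟪J.one, a • w⟫ = 0 := fun a => by rw [inner_smul_right, hw, mul_zero]
  refine ⟨?_, ?_, ?_⟩
  · rw [IsIdempotent, h.mul_self (hw' _), norm_smul, hn, smul_smul]
    congr 2
    · norm_num
    · field_simp; norm_num
  · intro h0
    rw [← zero_add (0 : V), ← zero_smul ℝ J.one,
      add_smul_eq_add_smul_iff he (hw' _) (by simp)] at h0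
    norm_num at h0
  · intro p q hp hq hpq
    obtain ⟨u, s, hu, rfl⟩ := exists_eq_add_smul he p
    obtain ⟨v, t, hv, rfl⟩ := exists_eq_add_smul he q
    rw [show u + s • J.one + (v + t • J.one) = (u + v) + (s + t) • J.one by module,
      add_smul_eq_add_smul_iff he (hw' _) (by rw [inner_add_right, hu, hv, add_zero])] at hpq
    rcases h.coeff_of_isIdempotent he hu hp with h1 | h1 | h1
    · exact Or.inl h1
    all_goals
      rcases h.coeff_of_isIdempotent he hv hq with h2 | h2 | h2
      · exact Or.inr h2
      all_goals exfalso; linarith [hpq.2]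

/-- Vectors orthogonal to the unit and of the same length are differences of Jordan frames. -/
theorem exists_isJordanFrame (h : J.IsSpin) (he : J.one ≠ 0) {w : V} (hw : ⟪J.one, w⟫ = 0)
    (hn : ‖w‖ = ‖J.one‖) : ∃ c : Fin 2 → V, J.IsJordanFrame c ∧ c 0 - c 1 = w := by
  have hen : ‖J.one‖ ≠ 0 := norm_ne_zero_iff.2 he
  have h0 := h.isPrimitive_half he hw hn
  have h1 := h.isPrimitive_half he (w := -w) (by rw [inner_neg_right, hw, neg_zero])
    (by rw [norm_neg, hn])
  have hww : J.mul w w = J.one := by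
    rw [h w hw, hn, div_self (pow_ne_zero _ hen), one_smul]
  have hm : J.mul ((1 / 2 : ℝ) • w + (1 / 2 : ℝ) • J.one)
      ((1 / 2 : ℝ) • -w + (1 / 2 : ℝ) • J.one) = 0 := by
    simp only [map_add, map_smul, map_neg, LinearMap.add_apply, LinearMap.smul_apply, J.one_mul,
      J.mul_one, hww]
    module
  refine ⟨![(1 / 2 : ℝ) • w + (1 / 2 : ℝ) • J.one, (1 / 2 : ℝ) • -w + (1 / 2 : ℝ) • J.one],
    ⟨?_, ?_, ?_⟩, ?_⟩
  · intro i
    fin_cases i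
    exacts [h0, h1]
  · intro i j hij
    fin_cases i <;> fin_cases j
    · exact absurd rfl hij
    · exact hm
    · exact (J.mul_comm _ _).trans hm
    · exact absurd rfl hij
  · simp only [Fin.sum_univ_two, Matrix.cons_val]
    module
  · simp only [Matrix.cons_val]
    module

/-- The difference of the members of a Jordan frame is orthogonal to the unit. -/
theorem inner_one_sub_of_isJordanFrame (h : J.IsSpin) (he : J.one ≠ 0) {c : Fin 2 → V}
    (hc : J.IsJordanFrame c) : ⟪J.one, c 0 - c 1⟫ = 0 := by
  obtain ⟨hp, -, hsum⟩ := hc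
  obtain ⟨u, s, hu, h0⟩ := exists_eq_add_smul he (c 0)
  obtain ⟨v, t, hv, h1⟩ := exists_eq_add_smul he (c 1)
  have hp0 := hp 0
  have hp1 := hp 1
  rw [Fin.sum_univ_two, h0, h1, show u + s • J.one + (v + t • J.one)
    = (u + v) + (s + t) • J.one by module] at hsum
  have hst : s + t = 1 := ((add_smul_eq_add_smul_iff he
    (by rw [inner_add_right, hu, hv, add_zero]) (inner_zero_right _)).1
    (hsum.trans (show J.one = 0 + (1 : ℝ) • J.one by module))).2
  rw [h0] at hp0
  rw [h1] at hp1
  have hs := (h.coeff_of_isIdempotent he hu hp0.1).resolve_left hp0.2.1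
  have ht := (h.coeff_of_isIdempotent he hv hp1.1).resolve_left hp1.2.1
  -- Both coefficients are `1 / 2` or `1` and they sum to `1`.
  have : s = t := by
    rcases hs with hs | hs <;> rcases ht with ht | ht <;> linarith
  rw [h0, h1, this, add_sub_add_right_eq_sub, inner_sub_right, hu, hv, sub_zero]

end IsSpin

/-- The normals given by Jordan frames are unit vectors for the trace inner product. -/
theorem IsTraceInner.norm_eq_one (h : J.IsTraceInner) {c : Fin 2 → V} {ε : ℝ}
    (hc : J.IsJordanFrame c) (hε : ε = 1 ∨ ε = -1) :
    ‖ε • ((√2 / 2) • c 0 - (√2 / 2) • c 1)‖ = 1 := by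
  have h00 : ⟪c 0, c 0⟫ = 1 := by
    rw [h (c 0) (c 0) 2 c ![1, 0] hc ((hc.1 0).1.trans (by simp))]; simp
  have h11 : ⟪c 1, c 1⟫ = 1 := by
    rw [h (c 1) (c 1) 2 c ![0, 1] hc ((hc.1 1).1.trans (by simp))]; simp
  have h01 : ⟪c 0, c 1⟫ = 0 := by
    rw [h (c 0) (c 1) 2 c ![0, 0] hc (by simpa using hc.2.1 0 1 (by decide))]; simp
  have hε1 : ‖ε‖ = 1 := by rcases hε with rfl | rfl <;> simp
  have h2 := Real.sq_sqrt (show (0 : ℝ) ≤ 2 by norm_num)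
  rw [norm_smul, hε1, _root_.one_mul, ← sq_eq_sq₀ (norm_nonneg _) zero_le_one, ← smul_sub,
    norm_smul, mul_pow, norm_sub_sq_real, ← real_inner_self_eq_norm_sq (c 0),
    ← real_inner_self_eq_norm_sq (c 1), h00, h11, h01, Real.norm_eq_abs, sq_abs]
  linarith

end EuclideanJordanAlgebra

/-! ### Lattice-like sets in rank two. -/

section RankTwo

variable {V : Type*} [NormedAddCommGroup V] [InnerProductSpace ℝ V] [FiniteDimensional ℝ V]

/-- Lattice-like convex bodies of a simple Euclidean Jordan algebra of rank two. -/
theorem isLatticeLike_squares_iff (J : EuclideanJordanAlgebra V) (hs : J.IsSimple)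
    (hr : J.rank = 2) {M : Set V} (hcl : IsClosed M) (hM : Convex ℝ M)
    (hint : (interior M).Nonempty) :
    IsLatticeLike J.squares M ↔
      ∃ (I : Set ℕ) (u a : ℕ → V) (c : ℕ → Fin 2 → V) (ε : ℕ → ℝ),
        (∀ i ∈ I, J.IsJordanFrame (c i) ∧ (ε i = 1 ∨ ε i = -1) ∧
          a i = ε i • ((√2 / 2) • c i 0 - (√2 / 2) • c i 1)) ∧
        M = ⋂ i ∈ I, lowerHalfspace (u i) (a i) := by
  have := hs.1
  have he : J.one ≠ 0 := J.one_ne_zero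
  have hen : 0 < ‖J.one‖ := norm_pos_iff.2 he
  have hspin := J.isSpin hs hr
  rw [(hspin.isCircularCone_squares he).isLatticeLike_iff he (J.exists_orthogonal hs hr) hcl hM
    hint]
  constructor
  · intro h
    -- This length makes `√2 • a i` as long as the unit, as `exists_isJordanFrame` requires.
    obtain ⟨I, u, a, ha, hMI⟩ := exists_eq_iInter_lowerHalfspace hcl hM
      (hint.mono interior_subset) h (r := √2 / 2 * ‖J.one‖) (by positivity)
    have hc : ∀ i, ∃ c : Fin 2 → V, i ∈ I → J.IsJordanFrame c ∧
        a i = (√2 / 2) • c 0 - (√2 / 2) • c 1 := by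
      intro i
      by_cases hi : i ∈ I
      · have h2 := Real.mul_self_sqrt (show (0 : ℝ) ≤ 2 by norm_num)
        obtain ⟨c, hc, hca⟩ := hspin.exists_isJordanFrame he (w := √2 • a i)
          (by rw [inner_smul_right, (ha i hi).1, mul_zero])
          (by
            rw [norm_smul, (ha i hi).2, Real.norm_of_nonneg (Real.sqrt_nonneg 2)]
            linear_combination (‖J.one‖ / 2) * h2)
        refine ⟨c, fun _ => ⟨hc, ?_⟩⟩
        rw [← smul_sub, hca, smul_smul, show √2 / 2 * √2 = 1 by linarith, one_smul]
      · exact ⟨0, fun h => absurd h hi⟩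
    choose c hc using hc
    exact ⟨I, u, a, c, fun _ => 1, fun i hi => ⟨(hc i hi).1, Or.inl rfl,
      by rw [one_smul, (hc i hi).2]⟩, hMI⟩
  · rintro ⟨I, u, a, c, ε, ha, rfl⟩ x hx t
    rw [Set.mem_iInter₂] at hx ⊢
    intro i hi
    obtain ⟨hc, -, hai⟩ := ha i hi
    have h0 : ⟪a i, J.one⟫ = 0 := by
      rw [real_inner_comm, hai, ← smul_sub, inner_smul_right, inner_smul_right,
        hspin.inner_one_sub_of_isJordanFrame he hc]
      simp
    have := hx i hi
    simp only [lowerHalfspace, Set.mem_ofPred_eq] at this ⊢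
    rwa [inner_add_right, inner_smul_right, h0, mul_zero, add_zero]

end RankTwo

/-! ### The Lorentz cone and cylinders. -/

section Lorentz

variable {m : ℕ}

theorem lorentzAlgebra_mul (p q : LorentzSpace m) : (lorentzAlgebra m).mul p q
    = WithLp.toLp 2 (q.snd • p.fst + p.snd • q.fst, ⟪p.fst, q.fst⟫ + p.snd * q.snd) := rfl

theorem lorentzAlgebra_one : (lorentzAlgebra m).one = WithLp.toLp 2 (0, 1) := rfl

theorem norm_lorentzAlgebra_one : ‖(lorentzAlgebra m).one‖ = 1 := by
  rw [lorentzAlgebra_one, WithLp.prod_norm_eq_of_L2]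
  simp

theorem inner_lorentzAlgebra_one (p : LorentzSpace m) : ⟪(lorentzAlgebra m).one, p⟫ = p.snd := by
  rw [lorentzAlgebra_one, WithLp.prod_inner_apply]
  simp

theorem lorentzAlgebra_one_ne_zero : (lorentzAlgebra m).one ≠ 0 := by
  rw [← norm_ne_zero_iff, norm_lorentzAlgebra_one]
  exact one_ne_zero

theorem isCircularCone_lorentzCone : IsCircularCone (lorentzAlgebra m).one (lorentzCone m) := by
  intro w t hw
  rw [inner_lorentzAlgebra_one] at hw
  rw [norm_lorentzAlgebra_one, WithLp.prod_norm_eq_of_L2, hw]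
  simp [lorentzCone, lorentzAlgebra_one, hw]

theorem isSpin_lorentzAlgebra : (lorentzAlgebra m).IsSpin := by
  intro w hw
  rw [inner_lorentzAlgebra_one] at hw
  rw [norm_lorentzAlgebra_one, lorentzAlgebra_mul, lorentzAlgebra_one,
    WithLp.prod_norm_sq_eq_of_L2, hw]
  refine LorentzSpace.ext' (fun i => ?_) ?_ <;> simp

theorem IsCircularCone.ext {V : Type*} [NormedAddCommGroup V] [InnerProductSpace ℝ V] {e : V}
    {Q Q' : Set V} (he : e ≠ 0) (h : IsCircularCone e Q) (h' : IsCircularCone e Q') : Q = Q' := by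
  ext x
  obtain ⟨w, t, hw, rfl⟩ := exists_eq_add_smul he x
  rw [h w t hw, h' w t hw]

theorem exists_ne_zero_inner_eq_zero (hm : 2 ≤ m) (v : EuclideanSpace ℝ (Fin m)) :
    ∃ u ≠ 0, ⟪v, u⟫ = 0 := by
  obtain ⟨u, hu, hu0⟩ := Submodule.exists_mem_ne_zero_of_ne_bot (p := (ℝ ∙ v)ᗮ) (by
    intro h
    have h1 := Submodule.finrank_add_finrank_orthogonal (ℝ ∙ v)
    have h2 := finrank_span_le_card (R := ℝ) ({v} : Set (EuclideanSpace ℝ (Fin m)))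
    rw [h, finrank_bot, finrank_euclideanSpace_fin] at h1
    rw [Set.toFinset_singleton, Finset.card_singleton] at h2
    omega)
  exact ⟨u, hu0, Submodule.mem_orthogonal_singleton_iff_inner_right.1 hu⟩

theorem lorentz_exists_orthogonal (hm : 2 ≤ m) (x : LorentzSpace m) :
    ∃ y ≠ 0, ⟪(lorentzAlgebra m).one, y⟫ = 0 ∧ ⟪x, y⟫ = 0 := by
  obtain ⟨u, hu, hxu⟩ := exists_ne_zero_inner_eq_zero hm x.fst
  refine ⟨WithLp.toLp 2 (u, 0), ?_, ?_, ?_⟩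
  · intro h
    exact hu (congrArg WithLp.fst h)
  · exact inner_lorentzAlgebra_one _
  · rw [WithLp.prod_inner_apply]
    simpa using hxu

/-- An ideal containing `(v, 0)` with `v ≠ 0` contains its square, hence the unit. Multiplying `y`
by `(u, 0)` with `u` orthogonal to `y.fst` gives `(y.snd • u, 0)`, so a proper ideal has only
elements `(v, 0)` and is zero. -/
theorem isSimple_lorentzAlgebra (hm : 2 ≤ m) : (lorentzAlgebra m).IsSimple := by
  refine ⟨⟨_, 0, lorentzAlgebra_one_ne_zero⟩, fun I hI => ?_⟩
  by_contra! H
  obtain ⟨y, hy, hy0⟩ := Submodule.exists_mem_ne_zero_of_ne_bot H.1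
  have htop : (lorentzAlgebra m).one ∉ I := by
    intro h
    refine H.2 (eq_top_iff.2 fun x _ => ?_)
    rw [← (lorentzAlgebra m).mul_one x]
    exact hI x _ h
  have hsq : ∀ v : EuclideanSpace ℝ (Fin m), WithLp.toLp 2 (v, (0 : ℝ)) ∈ I → v = 0 := by
    intro v hv
    by_contra hv0
    have h1 := hI (WithLp.toLp 2 (v, 0)) _ hv
    rw [isSpin_lorentzAlgebra _ (inner_lorentzAlgebra_one _)] at h1
    refine htop ((I.smul_mem_iff ?_).1 h1)
    rw [norm_lorentzAlgebra_one, WithLp.prod_norm_sq_eq_of_L2]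
    simpa using hv0
  obtain ⟨u, hu, hyu⟩ := exists_ne_zero_inner_eq_zero hm y.fst
  have h1 := hI (WithLp.toLp 2 (u, 0)) y hy
  have e1 : (lorentzAlgebra m).mul (WithLp.toLp 2 (u, 0)) y = WithLp.toLp 2 (y.snd • u, 0) :=
    LorentzSpace.ext' (fun i => by simp [lorentzAlgebra_mul])
      (by simp [lorentzAlgebra_mul, (real_inner_comm _ _).trans hyu])
  rw [e1] at h1
  have h2 : y.snd = 0 := (smul_eq_zero.1 (hsq _ h1)).resolve_right hu
  have h3 : y = WithLp.toLp 2 (y.fst, 0) := LorentzSpace.ext' (fun i => rfl) h2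
  rw [h3] at hy
  rw [hsq _ hy] at h3
  exact hy0 h3

theorem rank_lorentzAlgebra (hm : 2 ≤ m) : (lorentzAlgebra m).rank = 2 := by
  refine le_antisymm ?_ ?_
  · refine csSup_le ⟨_, 0, rfl⟩ ?_
    rintro _ ⟨x, rfl⟩
    obtain ⟨w, t, hw, rfl⟩ := exists_eq_add_smul lorentzAlgebra_one_ne_zero x
    refine EuclideanJordanAlgebra.degree_le_two _ (a := 2 * t) (b := ‖w‖ ^ 2 - t ^ 2) ?_
    rw [isSpin_lorentzAlgebra.mul_self hw, norm_lorentzAlgebra_one]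
    module
  · obtain ⟨y, hy0, hy, -⟩ := lorentz_exists_orthogonal hm 0
    refine le_trans ?_ ((lorentzAlgebra m).degree_le_rank y)
    obtain ⟨h0, hd⟩ := (lorentzAlgebra m).degree_spec y
    by_contra! hlt
    have h1 : (lorentzAlgebra m).degree y = 1 := by omega
    rw [h1] at hd
    refine hd (Fintype.linearIndependent_iff.2 fun g hg => ?_)
    replace hg := (Fin.sum_univ_two _).symm.trans hg
    change g 0 • (lorentzAlgebra m).pow y 0 + g 1 • (lorentzAlgebra m).pow y 1 = 0 at hg
    rw [EuclideanJordanAlgebra.pow_zero, EuclideanJordanAlgebra.pow_one] at hg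
    have h2 := (add_smul_eq_add_smul_iff lorentzAlgebra_one_ne_zero (v := g 1 • y) (w := 0)
      (s := g 0) (t := 0) (by rw [inner_smul_right, hy, mul_zero]) (inner_zero_right _)).1
      (by rw [zero_smul, add_zero, ← hg, add_comm])
    intro i
    fin_cases i
    · exact h2.2
    · exact (smul_eq_zero.1 h2.1).resolve_right hy0

/-- The sets invariant under translations along the axis are the cylinders. -/
theorem isLatticeLike_lorentzCone_iff (hm : 2 ≤ m) (M : Set (LorentzSpace m)) :
    (IsClosed M ∧ Convex ℝ M ∧ (interior M).Nonempty ∧ IsLatticeLike (lorentzCone m) M) ↔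
      ∃ C : Set (EuclideanSpace ℝ (Fin m)),
        IsClosed C ∧ Convex ℝ C ∧ (interior C).Nonempty ∧ M = cylinder C := by
  have hiff : ∀ {M : Set (LorentzSpace m)}, IsClosed M → Convex ℝ M → (interior M).Nonempty →
      (IsLatticeLike (lorentzCone m) M ↔ ∀ x ∈ M, ∀ t : ℝ, x + t • (lorentzAlgebra m).one ∈ M) :=
    fun h1 h2 h3 => isCircularCone_lorentzCone.isLatticeLike_iff lorentzAlgebra_one_ne_zero
      (lorentz_exists_orthogonal hm) h1 h2 h3
  constructor
  · rintro ⟨hcl, hM, hint, hL⟩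
    rw [hiff hcl hM hint] at hL
    have hmem : ∀ (p : LorentzSpace m) (t : ℝ), WithLp.toLp 2 (p.fst, t) ∈ M ↔ p ∈ M := by
      intro p t
      have e1 : WithLp.toLp 2 (p.fst, t) = p + (t - p.snd) • (lorentzAlgebra m).one :=
        LorentzSpace.ext' (fun i => by simp [lorentzAlgebra_one]) (by simp [lorentzAlgebra_one])
      refine ⟨fun h => ?_, fun h => e1 ▸ hL p h _⟩
      have := hL _ h (p.snd - t)
      rw [e1] at this
      convert this using 1
      module
    have hcont : ∀ t : ℝ, Continuous fun v : EuclideanSpace ℝ (Fin m) =>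
        (WithLp.toLp 2 (v, t) : LorentzSpace m) := fun t =>
      (WithLp.prod_continuous_toLp 2 _ _).comp (by fun_prop)
    refine ⟨{v | WithLp.toLp 2 (v, (0 : ℝ)) ∈ M}, hcl.preimage (hcont 0), ?_, ?_, ?_⟩
    · intro v hv w hw a b ha hb hab
      have e1 : (WithLp.toLp 2 (a • v + b • w, (0 : ℝ)) : LorentzSpace m)
          = a • WithLp.toLp 2 (v, (0 : ℝ)) + b • WithLp.toLp 2 (w, (0 : ℝ)) :=
        LorentzSpace.ext' (fun i => by simp) (by simp)
      rw [Set.mem_ofPred_eq, e1]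
      exact hM hv hw ha hb hab
    · obtain ⟨p, hp⟩ := hint
      refine ⟨p.fst, ?_⟩
      -- The slice is taken at the height of the interior point `p`; by `hmem` all slices agree.
      have h1 : (fun v : EuclideanSpace ℝ (Fin m) =>
          (WithLp.toLp 2 (v, p.snd) : LorentzSpace m)) ⁻¹' interior M
            ⊆ {v | WithLp.toLp 2 (v, (0 : ℝ)) ∈ M} := by
        intro v hv
        exact (hmem (WithLp.toLp 2 (v, p.snd)) 0).2 (interior_subset hv)
      exact interior_maximal h1 (isOpen_interior.preimage (hcont p.snd)) hp
    · ext p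
      exact (hmem p 0).symm
  · rintro ⟨C, hcl, hC, ⟨v, hv⟩, rfl⟩
    have hcont : Continuous fun p : LorentzSpace m => p.fst :=
      continuous_fst.comp (WithLp.prod_continuous_ofLp 2 _ _)
    have h1 : IsClosed (cylinder C) := hcl.preimage hcont
    have h2 : Convex ℝ (cylinder C) := fun p hp q hq a b ha hb hab => hC hp hq ha hb hab
    have h3 : (interior (cylinder C)).Nonempty :=
      ⟨WithLp.toLp 2 (v, 0), preimage_interior_subset_interior_preimage hcont hv⟩
    refine ⟨h1, h2, h3, (hiff h1 h2 h3).2 fun p hp t => ?_⟩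
    have e1 : (p + t • (lorentzAlgebra m).one).fst = p.fst := by simp [lorentzAlgebra_one]
    change (p + t • (lorentzAlgebra m).one).fst ∈ C
    rw [e1]
    exact hp

end Lorentz

theorem mainTheorem6 :
    (∀ (V : Type*) [NormedAddCommGroup V] [InnerProductSpace ℝ V] [FiniteDimensional ℝ V]
        (J : EuclideanJordanAlgebra V), J.IsSimple → J.rank = 2 →
      (∀ M : Set V, IsClosed M → Convex ℝ M → (interior M).Nonempty →
        (IsLatticeLike J.squares M ↔
          ∃ (I : Set ℕ) (u a : ℕ → V) (c : ℕ → Fin 2 → V) (ε : ℕ → ℝ),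
            (∀ i ∈ I, J.IsJordanFrame (c i) ∧ (ε i = 1 ∨ ε i = -1) ∧
              a i = ε i • ((√2 / 2) • c i 0 - (√2 / 2) • c i 1)) ∧
            M = ⋂ i ∈ I, lowerHalfspace (u i) (a i))) ∧
      (J.IsTraceInner → ∀ (c : Fin 2 → V) (ε : ℝ), J.IsJordanFrame c → (ε = 1 ∨ ε = -1) →
        ‖ε • ((√2 / 2) • c 0 - (√2 / 2) • c 1)‖ = 1)) ∧
    (∀ m : ℕ, 2 ≤ m →
      (lorentzAlgebra m).IsSimple ∧ (lorentzAlgebra m).rank = 2 ∧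
      (lorentzAlgebra m).squares = lorentzCone m ∧
      ∀ M : Set (LorentzSpace m),
        (IsClosed M ∧ Convex ℝ M ∧ (interior M).Nonempty ∧ IsLatticeLike (lorentzCone m) M) ↔
          ∃ C : Set (EuclideanSpace ℝ (Fin m)),
            IsClosed C ∧ Convex ℝ C ∧ (interior C).Nonempty ∧ M = cylinder C) := by
  refine ⟨fun V _ _ _ J hs hr => ⟨fun M hcl hM hint => isLatticeLike_squares_iff J hs hr hcl hM hint,
    fun h c ε hc hε => h.norm_eq_one hc hε⟩, fun m hm => ⟨isSimple_lorentzAlgebra hm,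
    rank_lorentzAlgebra hm, ?_, isLatticeLike_lorentzCone_iff hm⟩⟩
  exact (isSpin_lorentzAlgebra.isCircularCone_squares lorentzAlgebra_one_ne_zero).ext
    lorentzAlgebra_one_ne_zero isCircularCone_lorentzCone
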